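/- Let $k$ be a field; all vector spaces, algebras, coalgebras, bialgebras and tensor products are over $k$, and $\Delta(c)=c_1\otimes c_2$ (Sweedler notation). For a coalgebra $C$ and algebras $B,A$, a linear map $\psi\colon C\otimes B\to A$ is a *measuring* ("$C$ measures $B$ to $A$") if $\psi(c,bb')=\psi(c_1,b)\psi(c_2,b')$ and $\psi(c,1)=\varepsilon(c)1_A$. A measuring $\theta\colon M\otimes B\to A$ is *universal* if for every measuring $f\colon C\otimes B\to A$ there is a unique coalgebra map $\bar f\colon C\to M$ with $f=\theta(\bar f\otimes 1)$. If $N,T$ are bialgebras, a *bimeasuring* is a linear map $\psi\colon N\otimes T\to A$ such that $N$ measures $T$ to $A$ and $T$ measures $N$ to $A$ via $\psi$. A bimeasuring $\theta\colon B\otimes T\to A$ is *universal* if for every bimeasuring $f\colon N\otimes T\to A$ there is a unique bialgebra map $\bar f\colon N\to B$ with $f=\theta(\bar f\otimes 1)$. **Proposition.** Let $T$ be a bialgebra, $A$ a commutative algebra and $\theta\colon M\otimes T\to A$ the universal measuring. Then there is an algebra structure on $M$, whose multiplication $M\otimes M\to M$ and unit $k\to M$ are coalgebra maps, such that $T$ measures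 $M$ to $A$ via $\theta$, i.e. $\theta(fg,t)=\theta(f,t_1)\theta(g,t_2)$ and $\theta(1_M,t)=\varepsilon(t)1_A$ for $f,g\in M$, $t\in T$; and it is the only algebra structure on the vector space $M$ whose multiplication is a coalgebra map and for which $T$ measures $M$ to $A$ via $\theta$. With this algebra structure $M$ is a bialgebra and $\theta$ is the universal bimeasuring. If $T$ is a Hopf algebra, then so is $M$. -/

import Mathlib

open TensorProduct

universe u v w x

section Measuring

variable {k : Type*} [Field k]

/-- A linear map `ψ : C ⊗ B → A`, written as a bilinear map, is a measuring (`C` measures `B` to `A`)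
if `ψ(c, 1) = ε(c)` and `ψ(c, bb') = ∑ ψ(c₁, b) ψ(c₂, b')`. -/
structure IsMeasuring {C B A : Type*} [AddCommGroup C] [Module k C] [Coalgebra k C]
    [Ring B] [Algebra k B] [Ring A] [Algebra k A] (ψ : C →ₗ[k] B →ₗ[k] A) : Prop where
  map_one : ∀ c : C, ψ c 1 = algebraMap k A (Coalgebra.counit c)
  map_mul : ∀ (c : C) (b b' : B),
    ψ c (b * b') =
      LinearMap.mul' k A (TensorProduct.map (ψ.flip b) (ψ.flip b') (Coalgebra.comul c))

/-- The measuring `θ : M ⊗ B → A` is universal: every measuring `f : C ⊗ B → A` is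
`θ ∘ (g ⊗ 1)` for exactly one coalgebra map `g : C → M`. -/
def IsUniversalMeasuring {M : Type x} {B A : Type*} [AddCommGroup M] [Module k M] [Coalgebra k M]
    [Ring B] [Algebra k B] [Ring A] [Algebra k A] (θ : M →ₗ[k] B →ₗ[k] A) : Prop :=
  IsMeasuring θ ∧
    ∀ (C : Type x) [AddCommGroup C] [Module k C] [Coalgebra k C] (f : C →ₗ[k] B →ₗ[k] A),
      IsMeasuring f → ∃! g : C →ₗc[k] M, ∀ (c : C) (b : B), f c b = θ (g c) b

/-- `ψ : N ⊗ T → A` is a bimeasuring: `N` measures `T` to `A` and `T` measures `N` to `A`. -/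
def IsBimeasuring {N T A : Type*} [Ring N] [Bialgebra k N] [Ring T] [Bialgebra k T]
    [Ring A] [Algebra k A] (ψ : N →ₗ[k] T →ₗ[k] A) : Prop :=
  IsMeasuring ψ ∧ IsMeasuring ψ.flip

/-- The bimeasuring `θ : B ⊗ T → A` is (left) universal: every bimeasuring `f : N ⊗ T → A` is
`θ ∘ (g ⊗ 1)` for exactly one bialgebra map `g : N → B`. -/
def IsUniversalBimeasuring {B : Type x} {T A : Type*} [Ring B] [Bialgebra k B]
    [Ring T] [Bialgebra k T] [Ring A] [Algebra k A] (θ : B →ₗ[k] T →ₗ[k] A) : Prop :=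
  IsBimeasuring θ ∧
    ∀ (N : Type x) [Ring N] [Bialgebra k N] (f : N →ₗ[k] T →ₗ[k] A),
      IsBimeasuring f → ∃! g : N →ₐc[k] B, ∀ (n : N) (t : T), f n t = θ (g n) t

end Measuring

/-- The bialgebra `H` is a Hopf algebra, that is, it has an antipode. -/
def IsHopf (k H : Type*) [Field k] [Ring H] [inst : Bialgebra k H] : Prop :=
  ∃ h : HopfAlgebra k H, h.toHopfAlgebraStruct.toBialgebra = inst

/-- A (unital, associative) `k`-algebra structure on a given `k`-vector space `M`. -/
@[ext]
structure AlgebraStructure (k M : Type*) [Field k] [AddCommGroup M] [Module k M] where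
  mul : M →ₗ[k] M →ₗ[k] M
  one : M
  mul_assoc : ∀ a b c : M, mul (mul a b) c = mul a (mul b c)
  one_mul : ∀ a : M, mul one a = a
  mul_one : ∀ a : M, mul a one = a

namespace AlgebraStructure

variable {k M : Type*} [Field k] [AddCommGroup M] [Module k M]

/-- The ring with the given addition of `M` and the multiplication and unit of `S`. -/
abbrev toRing (S : AlgebraStructure k M) : Ring M :=
  { ‹AddCommGroup M› with
    mul := fun a b => S.mul a b
    one := S.one
    mul_assoc := S.mul_assoc
    one_mul := S.one_mul
    mul_one := S.mul_one
    left_distrib := fun a b c => map_add (S.mul a) b c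
    right_distrib := fun a b c => LinearMap.map_add₂ S.mul a b c
    zero_mul := fun a => LinearMap.map_zero₂ S.mul a
    mul_zero := fun a => map_zero (S.mul a) }

/-- The `k`-algebra with the given scalar multiplication of `M`. -/
abbrev toAlgebra (S : AlgebraStructure k M) : @Algebra k M _ S.toRing.toSemiring :=
  letI := S.toRing
  Algebra.ofModule (fun r a b => LinearMap.map_smul₂ S.mul r a b)
    (fun r a b => map_smul (S.mul a) r b)

/-- For the algebra structure `S` on `M`, the coalgebra `T` measures `M` to `A` through
`θ : M ⊗ T → A`, that is, `θ(fg, t) = ∑ θ(f, t₁) θ(g, t₂)` and `θ(1, t) = ε(t)`. -/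
def IsMeasuredBy {T A : Type*} [AddCommGroup T] [Module k T] [Coalgebra k T]
    [Ring A] [Algebra k A] (S : AlgebraStructure k M) (θ : M →ₗ[k] T →ₗ[k] A) : Prop :=
  letI := S.toRing
  letI := S.toAlgebra
  IsMeasuring (k := k) (C := T) (B := M) (A := A) θ.flip

variable [Coalgebra k M]

/-- The multiplication `M ⊗ M → M` is a coalgebra map. -/
def MulIsCoalgHom (S : AlgebraStructure k M) : Prop :=
  ∃ g : M ⊗[k] M →ₗc[k] M, ∀ a b : M, g (a ⊗ₜ[k] b) = S.mul a b

/-- The unit `k → M` is a coalgebra map. -/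
def OneIsCoalgHom (S : AlgebraStructure k M) : Prop :=
  ∃ g : k →ₗc[k] M, g 1 = S.one

/-- The bialgebra formed by the given coalgebra `M` and an algebra structure whose multiplication
and unit are coalgebra maps. -/
abbrev toBialgebra (S : AlgebraStructure k M) (hm : S.MulIsCoalgHom) (h1 : S.OneIsCoalgHom) :
    @Bialgebra k M _ S.toRing.toSemiring :=
  letI := S.toRing
  letI := S.toAlgebra
  Bialgebra.mk' k M (C := ‹Coalgebra k M›)
    (by
      obtain ⟨g, hg⟩ := h1
      have := CoalgHomClass.counit_comp_apply g (1 : k)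
      rw [hg] at this
      exact this.trans rfl)
    (by
      intro a b
      obtain ⟨g, hg⟩ := hm
      have := CoalgHomClass.counit_comp_apply g (a ⊗ₜ[k] b)
      rw [hg] at this
      exact this.trans (mul_comm _ _))
    (by
      obtain ⟨g, hg⟩ := h1
      have := CoalgHomClass.map_comp_comul_apply g (1 : k)
      rw [hg] at this
      rw [CommSemiring.comul_apply, TensorProduct.map_tmul] at this
      refine this.symm.trans ?_
      exact congrArg₂ (fun y z : M => y ⊗ₜ[k] z) hg hg)
    (by
      intro a b
      obtain ⟨g, hg⟩ := hm
      have := CoalgHomClass.map_comp_comul_apply g (a ⊗ₜ[k] b)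
      rw [hg] at this
      refine this.symm.trans ?_
      have key : ∀ p q : M ⊗[k] M,
          TensorProduct.map g.toLinearMap g.toLinearMap
            (TensorProduct.tensorTensorTensorComm k M M M M (p ⊗ₜ[k] q)) = p * q := by
        intro p q
        induction p with
        | zero => rw [TensorProduct.zero_tmul, map_zero, map_zero, zero_mul]
        | add p p' hp hp' => rw [TensorProduct.add_tmul, map_add, map_add, hp, hp', add_mul]
        | tmul m m' =>
          induction q with
          | zero => rw [TensorProduct.tmul_zero, map_zero, map_zero, mul_zero]
          | add q q' hq hq' => rw [TensorProduct.tmul_add, map_add, map_add, hq, hq', mul_add]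
          | tmul n n' =>
            rw [TensorProduct.tensorTensorTensorComm_tmul, Algebra.TensorProduct.tmul_mul_tmul]
            exact congrArg₂ (fun y z : M => y ⊗ₜ[k] z) (hg m n) (hg m' n')
      exact key _ _)

end AlgebraStructure

/-!
A linear map `θ : M ⊗ T → A` is also a linear map `M → Hom(T, A)`, and `T` measures `M` to `A` via
`θ` exactly when this map is multiplicative and unital for the convolution product
(`isMeasuring_flip_iff`). Since `A` is commutative and `T` is a bialgebra, the convolution
`(c ⊗ d, t) ↦ f(c, t₁) g(d, t₂)` of two measurings `f` and `g` is a measuring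
(`IsMeasuring.convPairing`), and so is `(r, t) ↦ r ε(t)` on `k`. By universality they give coalgebra
maps `M ⊗ M → M` and `k → M`. Coalgebra maps into `M` are determined by their pairing with `T`
(`IsUniversalMeasuring.hom_ext`), so that associativity, the unit laws, the uniqueness of the
structure, and the multiplicativity of the coalgebra map attached to a bimeasuring all follow from
the corresponding facts in the algebra `Hom(T, A)`.

If `T` has an antipode `S`, then `(m, t) ↦ θ(m, S t)` is a measuring by the co-opposite coalgebra of
`M`, which yields `σ : M → M` reversing the comultiplication, with `θ(σ m, t) = θ(m, S t)`. The maps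
`m ↦ m₁ σ(m₂)` and `m ↦ ε(m) 1` pair equally with `T`, but this alone does not make them equal: the
first is not known to be a coalgebra map, and `M → Hom(T, A)` need not be injective. However,
`Δ(m₁ σ(m₂)) = m₁ σ(m₄) ⊗ m₂ σ(m₃)` shows that the image `I` of their difference is a coideal
(`map_mkQ_nested_convMul`). A coideal `I` on which `θ` vanishes is zero, because `θ` factors through
the coalgebra `M ⧸ I`, and universality then splits `M → M ⧸ I`
(`IsUniversalMeasuring.eq_bot_of_isCoideal`). The same argument applies to `m ↦ σ(m₁) m₂`.
-/

section

open Coalgebra WithConv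

/-! ### Measurings and their convolution -/

section Measurings

variable {k C D B T A : Type*} [Field k]
  [AddCommGroup C] [Module k C] [AddCommGroup D] [Module k D]

section Pairing
variable [AddCommGroup T] [Module k T] [Coalgebra k T] [Ring A] [Algebra k A]

/-- The pairing `(c ⊗ d, t) ↦ f(c, t₁) g(d, t₂)`: the convolution product of `f c` and `g d`. -/
noncomputable def convPairing
    (f : C →ₗ[k] T →ₗ[k] A) (g : D →ₗ[k] T →ₗ[k] A) : C ⊗[k] D →ₗ[k] T →ₗ[k] A :=
  TensorProduct.lift <| LinearMap.mk₂ k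
    (fun c d => (toConv (f c) * toConv (g d)).ofConv)
    (fun c c' d => by simp [add_mul]) (fun r c d => by simp)
    (fun c d d' => by simp [mul_add]) (fun r c d => by simp)

theorem convPairing_tmul
    (f : C →ₗ[k] T →ₗ[k] A) (g : D →ₗ[k] T →ₗ[k] A) (c : C) (d : D) :
    convPairing f g (c ⊗ₜ d) = (toConv (f c) * toConv (g d)).ofConv := rfl

theorem convPairing_tmul_repr
    (f : C →ₗ[k] T →ₗ[k] A) (g : D →ₗ[k] T →ₗ[k] A) (c : C) (d : D)
    {ι : Type*} {t : T} (r : Repr k t ι) :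
    convPairing f g (c ⊗ₜ d) t = ∑ i ∈ r.index, f c (r.left i) * g d (r.right i) :=
  r.convMul_apply (toConv (f c)) (toConv (g d))

end Pairing

variable [Coalgebra k C] [Coalgebra k D]

theorem IsMeasuring.map_mul_repr [Ring B] [Algebra k B] [Ring A] [Algebra k A]
    {ψ : C →ₗ[k] B →ₗ[k] A} (hψ : IsMeasuring ψ) {ι : Type*} {c : C} (r : Repr k c ι) (b b' : B) :
    ψ c (b * b') = ∑ i ∈ r.index, ψ (r.left i) b * ψ (r.right i) b' := by
  simp [hψ.map_mul, ← r.eq]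

theorem IsMeasuring.comp_coalgHom [Ring B] [Algebra k B] [Ring A] [Algebra k A]
    {ψ : D →ₗ[k] B →ₗ[k] A} (hψ : IsMeasuring ψ) (g : C →ₗc[k] D) :
    IsMeasuring (ψ ∘ₗ g.toLinearMap) where
  map_one c := by
    simp [hψ.map_one]
  map_mul c b b' := by
    have h : comul (R := k) (g c) = TensorProduct.map g.toLinearMap g.toLinearMap (comul c) :=
      (CoalgHomClass.map_comp_comul_apply g c).symm
    change ψ (g c) (b * b') = _
    rw [hψ.map_mul, h, TensorProduct.map_map]
    rfl

/-- The convolution of two measurings is a measuring. Commutativity of `A` is needed to interchange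
the middle factors of `f(c₁, t₁) f(c₂, t₁') g(d₁, t₂) g(d₂, t₂')`. -/
theorem IsMeasuring.convPairing [Ring T] [Bialgebra k T] [CommRing A] [Algebra k A]
    {f : C →ₗ[k] T →ₗ[k] A} {g : D →ₗ[k] T →ₗ[k] A} (hf : IsMeasuring f) (hg : IsMeasuring g) :
    IsMeasuring (convPairing f g) where
  map_one x := by
    induction x with
    | zero => simp
    | add x y hx hy => simp [hx, hy]
    | tmul c d =>
      simp [convPairing_tmul, Algebra.TensorProduct.one_def, hf.map_one, hg.map_one, mul_comm]
  map_mul x t t' := by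
    induction x with
    | zero => simp
    | add x y hx hy => simp [hx, hy]
    | tmul c d =>
      rw [convPairing_tmul_repr f g c d ((ℛ k t).mul (ℛ k t'))]
      simp only [Repr.mul_index, Repr.mul_left, Repr.mul_right, hf.map_mul_repr (ℛ k c),
        hg.map_mul_repr (ℛ k d), TensorProduct.comul_tmul]
      rw [← (ℛ k c).eq, ← (ℛ k d).eq]
      simp only [TensorProduct.sum_tmul, TensorProduct.tmul_sum, map_sum,
        TensorProduct.AlgebraTensorModule.tensorTensorTensorComm_tmul, TensorProduct.map_tmul,
        LinearMap.mul'_apply, LinearMap.flip_apply, convPairing_tmul_repr _ _ _ _ (ℛ k t),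
        convPairing_tmul_repr _ _ _ _ (ℛ k t'), Finset.sum_mul_sum, Finset.sum_product]
      simp only [← Finset.sum_product']
      -- Both sides sum over the same four indices, in opposite orders.
      refine Finset.sum_nbij' (fun p => (p.2.2.2, p.2.2.1, p.2.1, p.1))
        (fun p => (p.2.2.2, p.2.2.1, p.2.1, p.1)) (by simp; tauto) (by simp; tauto)
        (by simp) (by simp) fun p _ => mul_mul_mul_comm _ _ _ _

/-- The pairing `(r, t) ↦ r ε(t)`. -/
noncomputable def counitPairing (k T A : Type*) [Field k] [AddCommGroup T] [Module k T]
    [Coalgebra k T] [Ring A] [Algebra k A] : k →ₗ[k] T →ₗ[k] A :=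
  LinearMap.toSpanSingleton k _ (1 : WithConv (T →ₗ[k] A)).ofConv

theorem isMeasuring_counitPairing [Ring T] [Bialgebra k T] [Ring A] [Algebra k A] :
    IsMeasuring (counitPairing k T A) where
  map_one r := by
    simp [counitPairing, Algebra.smul_def]
  map_mul r t t' := by
    simp [counitPairing, Algebra.smul_def, ← map_mul, mul_left_comm]

end Measurings

/-! ### Consequences of the universal property -/

section Universal

variable {k T A : Type*} [Field k] {M C : Type x} [AddCommGroup M] [Module k M] [Coalgebra k M]
  [AddCommGroup C] [Module k C] [Coalgebra k C] [Ring T] [Algebra k T] [Ring A] [Algebra k A]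
  {θ : M →ₗ[k] T →ₗ[k] A}

theorem IsUniversalMeasuring.hom_ext (hθ : IsUniversalMeasuring θ) {g h : C →ₗc[k] M}
    (H : ∀ c, θ (g c) = θ (h c)) : g = h :=
  (hθ.2 C _ (hθ.1.comp_coalgHom g)).unique (fun _ _ => rfl) (fun c t => by
    rw [← H c]; rfl)

theorem IsUniversalMeasuring.exists_hom (hθ : IsUniversalMeasuring θ) {f : C →ₗ[k] T →ₗ[k] A}
    (hf : IsMeasuring f) : ∃ g : C →ₗc[k] M, ∀ c, θ (g c) = f c := by
  obtain ⟨g, hg, -⟩ := hθ.2 C f hf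
  exact ⟨g, fun c => LinearMap.ext fun t => (hg c t).symm⟩

/-- A universal measuring vanishes on no nonzero coideal: it would factor through the quotient
coalgebra, and then so would the identity of `M`. -/
theorem IsUniversalMeasuring.eq_bot_of_isCoideal (hθ : IsUniversalMeasuring θ)
    (I : Submodule k M) [I.IsCoideal] (hI : ∀ x ∈ I, θ x = 0) : I = ⊥ := by
  have hq : IsMeasuring (I.liftQ θ hI) :=
    { map_one := fun q => by
        obtain ⟨m, rfl⟩ := I.mkQ_surjective q
        exact hθ.1.map_one m
      map_mul := fun q b b' => by
        obtain ⟨m, rfl⟩ := I.mkQ_surjective q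
        have := hθ.1.map_mul m b b'
        simp only [Submodule.mkQ_apply, Coalgebra.Quotient.comul_mk, TensorProduct.map_map]
        exact this }
  obtain ⟨g, hg⟩ := hθ.exists_hom hq
  have hid : g.comp (Coalgebra.Quotient.mkQCoalgHom I) = CoalgHom.id k M :=
    hθ.hom_ext fun m => hg _
  rw [eq_bot_iff]
  intro m hm
  have h := DFunLike.congr_fun hid m
  simpa [(Submodule.Quotient.mk_eq_zero I).2 hm] using h.symm

end Universal

/-! ### Universal bimeasurings -/

/-- `T` measures `M` to `A` exactly when `M → Hom(T, A)` is multiplicative and unital for the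
convolution product. -/
theorem isMeasuring_flip_iff {k T A M : Type*} [Field k] [AddCommGroup T] [Module k T]
    [Coalgebra k T] [Ring A] [Algebra k A] [Ring M] [Algebra k M] {θ : M →ₗ[k] T →ₗ[k] A} :
    IsMeasuring θ.flip ↔ toConv (θ 1) = 1 ∧
      ∀ a b, toConv (θ (a * b)) = toConv (θ a) * toConv (θ b) := by
  constructor
  · intro h
    exact ⟨WithConv.ext <| LinearMap.ext h.map_one,
      fun a b => WithConv.ext <| LinearMap.ext fun t => h.map_mul t a b⟩
  · rintro ⟨h1, hm⟩
    exact ⟨fun t => congr($h1 t), fun t a b => congr($(hm a b) t)⟩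

section BialgebraCase

variable {k T A : Type*} [Field k] {M : Type x} [Ring M] [Bialgebra k M]
  [Ring T] [Bialgebra k T] [CommRing A] [Algebra k A] {θ : M →ₗ[k] T →ₗ[k] A}

/-- A universal measuring that is a bimeasuring is a universal bimeasuring. -/
theorem IsUniversalMeasuring.isUniversalBimeasuring (hθ : IsUniversalMeasuring θ)
    (hθ' : IsMeasuring θ.flip) : IsUniversalBimeasuring θ := by
  refine ⟨⟨hθ.1, hθ'⟩, fun N _ _ f hf => ?_⟩
  obtain ⟨g, hg, hguniq⟩ := hθ.2 N f hf.1
  have hgθ (n : N) : θ (g n) = f n := LinearMap.ext fun t => (hg n t).symm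
  obtain ⟨hθ1, hθm⟩ := isMeasuring_flip_iff.1 hθ'
  obtain ⟨hf1, hfm⟩ := isMeasuring_flip_iff.1 hf.2
  -- The coalgebra maps `N ⊗ N → M`, `n ⊗ n' ↦ g (n n')` and `n ⊗ n' ↦ g n * g n'`.
  have hmul : g.comp (Bialgebra.mulCoalgHom k N) =
      (Bialgebra.mulCoalgHom k M).comp (Coalgebra.TensorProduct.map g g) := by
    refine hθ.hom_ext fun z => ?_
    induction z with
    | zero => simp
    | add x y hx hy => rw [map_add, map_add, hx, hy, map_add, map_add]
    | tmul n n' =>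
      apply toConv_injective
      change toConv (θ (g (n * n'))) = toConv (θ (g n * g n'))
      rw [hθm, hgθ, hgθ, hgθ, hfm]
  -- The coalgebra maps `N → M`, `n ↦ ε(n) g 1` and `n ↦ ε(n) 1`.
  have hone : (g.comp (Bialgebra.unitBialgHom k N).toCoalgHom).comp (counitCoalgHom k N) =
      (Bialgebra.unitBialgHom k M).toCoalgHom.comp (counitCoalgHom k N) := by
    refine hθ.hom_ext fun n => ?_
    apply toConv_injective
    change toConv (θ (g (algebraMap k N (counit n)))) = toConv (θ (algebraMap k M (counit n)))
    simp [Algebra.algebraMap_eq_smul_one, hgθ, hf1, hθ1]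
  let G : N →ₐc[k] M :=
    { g with
      map_one' := by
        have h := DFunLike.congr_fun hone 1
        change g (algebraMap k N (counit 1)) = algebraMap k M (counit (1 : N)) at h
        simpa using h
      map_mul' := fun n n' => by simpa using DFunLike.congr_fun hmul (n ⊗ₜ n') }
  refine ⟨G, hg, fun G' hG' => ?_⟩
  ext n
  exact DFunLike.congr_fun (hguniq G'.toCoalgHom hG') n

end BialgebraCase

/-! ### The algebra structure of the universal measuring coalgebra -/

section Structure

variable {k : Type u} {T A : Type*} [Field k] {M : Type (max u x)} [AddCommGroup M] [Module k M]

/-- In terms of the convolution product, `T` measures `M` to `A` for the algebra structure `S`. -/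
theorem AlgebraStructure.isMeasuredBy_iff [AddCommGroup T] [Module k T] [Coalgebra k T] [Ring A]
    [Algebra k A] {θ : M →ₗ[k] T →ₗ[k] A} {S : AlgebraStructure k M} :
    S.IsMeasuredBy θ ↔ toConv (θ S.one) = 1 ∧
      ∀ a b, toConv (θ (S.mul a b)) = toConv (θ a) * toConv (θ b) :=
  letI := S.toRing
  letI := S.toAlgebra
  isMeasuring_flip_iff

variable [Coalgebra k M]

/-- A measuring by `k` also factors through a universal measuring. The ground field may lie in a
smaller universe than `M`, so the universal property is applied to a copy of `k` in the universe of
`M`. -/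
theorem IsUniversalMeasuring.exists_hom_field [Ring T] [Algebra k T] [Ring A] [Algebra k A]
    {θ : M →ₗ[k] T →ₗ[k] A}
    (hθ : IsUniversalMeasuring θ) {f : k →ₗ[k] T →ₗ[k] A} (hf : IsMeasuring f) :
    ∃ g : k →ₗc[k] M, ∀ r, θ (g r) = f r := by
  let p : (PUnit.{(max u x) + 1} →₀ k) →ₗc[k] k :=
    counitCoalgHom k (PUnit.{(max u x) + 1} →₀ k)
  let i : k →ₗc[k] (PUnit.{(max u x) + 1} →₀ k) :=
    { Finsupp.lsingle PUnit.unit with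
      counit_comp := by ext; simp
      map_comp_comul := by ext : 1; simp }
  obtain ⟨g, hg⟩ := hθ.exists_hom (hf.comp_coalgHom p)
  refine ⟨g.comp i, fun r => (hg (i r)).trans ?_⟩
  simp [p, i]

/-- The multiplication of `M` corresponds to the convolution of `θ` with itself, the unit to the
measuring `(r, t) ↦ r ε(t)`. The axioms are equalities of coalgebra maps into `M`, hence follow from
those of the convolution algebra `Hom(T, A)`. -/
theorem IsUniversalMeasuring.exists_algebraStructure [Ring T] [Bialgebra k T] [CommRing A]
    [Algebra k A] {θ : M →ₗ[k] T →ₗ[k] A} (hθ : IsUniversalMeasuring θ) :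
    ∃ S : AlgebraStructure k M, S.IsMeasuredBy θ ∧ S.MulIsCoalgHom ∧ S.OneIsCoalgHom := by
  obtain ⟨m, hm⟩ := hθ.exists_hom (hθ.1.convPairing hθ.1)
  obtain ⟨e, he⟩ := hθ.exists_hom_field (isMeasuring_counitPairing (k := k) (T := T) (A := A))
  have hm' (a b : M) : toConv (θ (m (a ⊗ₜ b))) = toConv (θ a) * toConv (θ b) := by
    rw [hm, convPairing_tmul]
  have he' : toConv (θ (e 1)) = 1 := by
    rw [he]; simp [counitPairing]
  have hassoc : m.comp (Coalgebra.TensorProduct.map m (.id k M)) =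
      (m.comp (Coalgebra.TensorProduct.map (.id k M) m)).comp
        (Coalgebra.TensorProduct.assoc k k M M M).toCoalgHom := by
    refine hθ.hom_ext fun z => LinearMap.congr_fun (f := θ ∘ₗ CoalgHom.toLinearMap _)
      (g := θ ∘ₗ CoalgHom.toLinearMap _) (TensorProduct.ext_threefold fun a b c => ?_) z
    apply toConv_injective
    change toConv (θ (m (m (a ⊗ₜ b) ⊗ₜ c))) = toConv (θ (m (a ⊗ₜ m (b ⊗ₜ c))))
    simp only [hm', mul_assoc]
  have hone_mul : (m.comp (Coalgebra.TensorProduct.map e (.id k M))).comp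
      (Coalgebra.TensorProduct.lid k M).symm.toCoalgHom = .id k M := by
    refine hθ.hom_ext fun a => toConv_injective ?_
    change toConv (θ (m (e 1 ⊗ₜ a))) = toConv (θ a)
    rw [hm', he', one_mul]
  have hmul_one : (m.comp (Coalgebra.TensorProduct.map (.id k M) e)).comp
      (Coalgebra.TensorProduct.rid k k M).symm.toCoalgHom = .id k M := by
    refine hθ.hom_ext fun a => toConv_injective ?_
    change toConv (θ (m (a ⊗ₜ e 1))) = toConv (θ a)
    rw [hm', he', mul_one]
  let S : AlgebraStructure k M :=
    { mul := TensorProduct.curry m.toLinearMap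
      one := e 1
      mul_assoc := fun a b c => DFunLike.congr_fun hassoc ((a ⊗ₜ b) ⊗ₜ c)
      one_mul := fun a => DFunLike.congr_fun hone_mul a
      mul_one := fun a => DFunLike.congr_fun hmul_one a }
  exact ⟨S, AlgebraStructure.isMeasuredBy_iff.2 ⟨he', hm'⟩, ⟨m, fun _ _ => rfl⟩, ⟨e, rfl⟩⟩

theorem IsUniversalMeasuring.algebraStructure_unique [Ring T] [Bialgebra k T] [Ring A]
    [Algebra k A] {θ : M →ₗ[k] T →ₗ[k] A} (hθ : IsUniversalMeasuring θ)
    {S S' : AlgebraStructure k M} (hS : S.MulIsCoalgHom) (hS' : S'.MulIsCoalgHom)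
    (h : S.IsMeasuredBy θ) (h' : S'.IsMeasuredBy θ) : S' = S := by
  obtain ⟨m, hm⟩ := hS
  obtain ⟨m', hm'⟩ := hS'
  have hmm : m' = m := hθ.hom_ext fun z => by
    induction z with
    | zero => simp
    | add x y hx hy => rw [map_add, map_add, hx, hy, map_add, map_add]
    | tmul a b =>
      apply toConv_injective
      rw [hm, hm', (AlgebraStructure.isMeasuredBy_iff.1 h).2,
        (AlgebraStructure.isMeasuredBy_iff.1 h').2]
  have hmul (a b : M) : S'.mul a b = S.mul a b := by rw [← hm, ← hm', hmm]
  ext a b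
  · exact hmul a b
  · rw [← S.mul_one S'.one, ← hmul, S'.one_mul]

end Structure

/-! ### The co-opposite coalgebra -/

section CoOpposite

variable {k : Type*} [Field k]

/-- The co-opposite coalgebra of `C`: the same vector space and counit, with the comultiplication
`c ↦ c₂ ⊗ c₁`. -/
def CoOpposite (C : Type*) : Type _ := C

variable {C : Type*} [AddCommGroup C] [Module k C]

instance : AddCommGroup (CoOpposite C) := inferInstanceAs (AddCommGroup C)

instance : Module k (CoOpposite C) := inferInstanceAs (Module k C)

variable (k C) in
/-- The identity of `C`, as a linear map from the co-opposite coalgebra. -/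
def CoOpposite.unop : CoOpposite C ≃ₗ[k] C := LinearEquiv.refl k C

noncomputable instance [Coalgebra k C] : Coalgebra k (CoOpposite C) where
  comul := (TensorProduct.comm k C C).toLinearMap ∘ₗ comul (R := k) (A := C)
  counit := counit (R := k) (A := C)
  coassoc := by
    refine LinearMap.ext fun (c : C) => ?_
    -- The claim is the coassociativity of `C` with the three factors in reverse order.
    let rev : C ⊗[k] (C ⊗[k] C) →ₗ[k] C ⊗[k] (C ⊗[k] C) :=
      (TensorProduct.assoc k C C C).toLinearMap ∘ₗ
        (TensorProduct.comm k C C).toLinearMap.rTensor C ∘ₗ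
          (TensorProduct.comm k C (C ⊗[k] C)).toLinearMap
    have h₁ (z : C ⊗[k] C) :
        TensorProduct.assoc k C C C (((TensorProduct.comm k C C).toLinearMap ∘ₗ comul).rTensor C
          (TensorProduct.comm k C C z)) = rev (comul.lTensor C z) := by
      induction z with
      | zero => simp
      | add x y hx hy => simp only [map_add, hx, hy]
      | tmul x y => rfl
    have h₂ (z : C ⊗[k] C) :
        ((TensorProduct.comm k C C).toLinearMap ∘ₗ comul).lTensor C (TensorProduct.comm k C C z) =
          rev (TensorProduct.assoc k C C C (comul.rTensor C z)) := by
      induction z with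
      | zero => simp
      | add x y hx hy => simp only [map_add, hx, hy]
      | tmul x y =>
        have h (w : C ⊗[k] C) : y ⊗ₜ TensorProduct.comm k C C w =
            rev (TensorProduct.assoc k C C C (w ⊗ₜ y)) := by
          induction w with
          | zero => simp
          | add x y hx hy =>
            simp only [map_add, TensorProduct.tmul_add, TensorProduct.add_tmul, hx, hy]
          | tmul x y => rfl
        exact h (comul x)
    exact (h₁ (comul c)).trans (((h₂ (comul c)).trans (congrArg rev (coassoc_apply c))).symm)
  rTensor_counit_comp_comul := by
    refine LinearMap.ext fun (c : C) => ?_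
    have h (z : C ⊗[k] C) : (counit (R := k) (A := C)).rTensor C (TensorProduct.comm k C C z) =
        TensorProduct.comm k C k (counit.lTensor C z) := by
      induction z with
      | zero => simp
      | add x y hx hy => simp only [map_add, hx, hy]
      | tmul x y => rfl
    exact (h (comul c)).trans (by rw [lTensor_counit_comul]; rfl)
  lTensor_counit_comp_comul := by
    refine LinearMap.ext fun (c : C) => ?_
    have h (z : C ⊗[k] C) : (counit (R := k) (A := C)).lTensor C (TensorProduct.comm k C C z) =
        TensorProduct.comm k k C (counit.rTensor C z) := by
      induction z with
      | zero => simp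
      | add x y hx hy => simp only [map_add, hx, hy]
      | tmul x y => rfl
    exact (h (comul c)).trans (by rw [rTensor_counit_comul]; rfl)

theorem CoOpposite.comul_eq [Coalgebra k C] (c : CoOpposite C) :
    comul (R := k) c = TensorProduct.map (unop k C).symm.toLinearMap (unop k C).symm.toLinearMap
      (TensorProduct.comm k C C (comul (unop k C c))) :=
  (LinearMap.congr_fun TensorProduct.map_id _).symm

theorem CoOpposite.counit_eq [Coalgebra k C] (c : CoOpposite C) :
    counit (R := k) c = counit (R := k) (unop k C c) := rfl

end CoOpposite

/-! ### Nested convolution products in a bialgebra -/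

section Antipode

variable {k : Type*} [Field k]

/-- `c₁ ⊗ c₂ ⊗ c₃ ⊗ c₄` bracketed as `(c₁ ⊗ c₂) ⊗ (c₃ ⊗ c₄)` and as `c₁ ⊗ ((c₂ ⊗ c₃) ⊗ c₄)`. -/
theorem Coalgebra.map_comul_comul_comp_comul {C : Type*} [AddCommGroup C] [Module k C]
    [Coalgebra k C] :
    _root_.TensorProduct.map comul comul ∘ₗ comul =
      (_root_.TensorProduct.assoc k C C (C ⊗[k] C)).symm.toLinearMap ∘ₗ
      ((_root_.TensorProduct.assoc k C C C).toLinearMap ∘ₗ comul.rTensor C ∘ₗ comul).lTensor C ∘ₗ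
        (comul : C →ₗ[k] C ⊗[k] C) := by
  simp [coassoc_simps]

variable {H : Type*} [Ring H] [Bialgebra k H]

/-- If `I` contains `f(x₁) g(x₂) - ε(x)` for all `x`, then modulo `I` in both factors
`f(x₁) g(x₄) ⊗ f(x₂) g(x₃) = f(x₁) g(x₂) ⊗ 1 = ε(x) 1 ⊗ 1`. -/
theorem map_mkQ_nested_convMul (f g : H →ₗ[k] H) (I : Submodule k H)
    (hI : ∀ x, (toConv f * toConv g - 1) x ∈ I) (x : H) :
    TensorProduct.map I.mkQ I.mkQ (LinearMap.mul' k (H ⊗[k] H)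
      (TensorProduct.map (TensorProduct.map f f)
        (TensorProduct.map g g ∘ₗ (TensorProduct.comm k H H).toLinearMap)
        (TensorProduct.map comul comul (comul x)))) =
      counit (R := k) x • (I.mkQ 1 ⊗ₜ I.mkQ 1) := by
  have hq (x : H) : I.mkQ (LinearMap.mul' k H (TensorProduct.map f g (comul x))) =
      counit (R := k) x • I.mkQ 1 := by
    rw [← map_smul, ← sub_eq_zero, ← map_sub, Submodule.mkQ_apply, Submodule.Quotient.mk_eq_zero,
      ← Algebra.algebraMap_eq_smul_one]
    exact hI x
  have h := LinearMap.congr_fun (Coalgebra.map_comul_comul_comp_comul (k := k) (C := H)) x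
  simp only [LinearMap.comp_apply] at h
  rw [h]
  -- Contracting with `q` first in the middle, then on the outside by `Ψ`, computes the left
  -- side from `x₁ ⊗ ((x₂ ⊗ x₃) ⊗ x₄)`.
  let q : H ⊗[k] H →ₗ[k] H ⧸ I := I.mkQ ∘ₗ LinearMap.mul' k H ∘ₗ TensorProduct.map f g
  let Ψ : H ⊗[k] ((H ⧸ I) ⊗[k] H) →ₗ[k] (H ⧸ I) ⊗[k] (H ⧸ I) :=
    TensorProduct.map q .id ∘ₗ (TensorProduct.assoc k H H (H ⧸ I)).symm.toLinearMap ∘ₗ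
      (TensorProduct.comm k (H ⧸ I) H).toLinearMap.lTensor H
  have hΨ (z : H ⊗[k] ((H ⊗[k] H) ⊗[k] H)) :
      TensorProduct.map I.mkQ I.mkQ (LinearMap.mul' k (H ⊗[k] H)
        (TensorProduct.map (TensorProduct.map f f)
          (TensorProduct.map g g ∘ₗ (TensorProduct.comm k H H).toLinearMap)
          ((TensorProduct.assoc k H H (H ⊗[k] H)).symm
            ((TensorProduct.assoc k H H H).toLinearMap.lTensor H z)))) =
      Ψ ((q.rTensor H).lTensor H z) := by
    refine LinearMap.congr_fun
      (f := TensorProduct.map I.mkQ I.mkQ ∘ₗ LinearMap.mul' k (H ⊗[k] H) ∘ₗ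
        TensorProduct.map (TensorProduct.map f f)
          (TensorProduct.map g g ∘ₗ (TensorProduct.comm k H H).toLinearMap) ∘ₗ
          (TensorProduct.assoc k H H (H ⊗[k] H)).symm.toLinearMap ∘ₗ
            (TensorProduct.assoc k H H H).toLinearMap.lTensor H)
      (g := Ψ ∘ₗ (q.rTensor H).lTensor H) ?_ z
    ext a b c d
    simp [Ψ, q]
  have hinner (y : H) : q.rTensor H (comul.rTensor H (comul y)) = I.mkQ 1 ⊗ₜ y := by
    rw [← (ℛ k y).eq]
    simp only [map_sum, LinearMap.rTensor_tmul]
    simp only [q, LinearMap.comp_apply, hq, TensorProduct.smul_tmul, ← TensorProduct.tmul_sum,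
      sum_counit_smul]
  rw [LinearMap.lTensor_comp_apply, LinearEquiv.coe_coe, hΨ, ← LinearMap.lTensor_comp_apply,
    ← (ℛ k x).eq]
  simp only [map_sum, LinearMap.lTensor_tmul, LinearMap.comp_apply, hinner]
  have h₁ := congr($(hq x) ⊗ₜ[k] I.mkQ 1)
  rw [← (ℛ k x).eq] at h₁
  simpa [Ψ, q, TensorProduct.sum_tmul, TensorProduct.smul_tmul'] using h₁

end Antipode

/-! ### The antipode -/

section Hopf

variable {k T A : Type*} [Field k]

/-- For a Hopf algebra `T`, the pairing `(c, t) ↦ θ(c, S t)` is a measuring by the co-opposite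
coalgebra, because the antipode `S` reverses products and `A` is commutative. -/
theorem IsMeasuring.comp_antipode {C : Type*} [AddCommGroup C] [Module k C] [Coalgebra k C]
    [Ring T] [HopfAlgebra k T] [CommRing A] [Algebra k A] {θ : C →ₗ[k] T →ₗ[k] A}
    (hθ : IsMeasuring θ) :
    IsMeasuring (θ.compl₂ (HopfAlgebra.antipode k) ∘ₗ (CoOpposite.unop k C).toLinearMap) where
  map_one c := by
    simp [hθ.map_one, CoOpposite.counit_eq]
  map_mul c t t' := by
    rw [CoOpposite.comul_eq, ← (ℛ k (CoOpposite.unop k C c)).eq]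
    simp [HopfAlgebra.antipode_mul_antidistrib, hθ.map_mul_repr (ℛ k (CoOpposite.unop k C c)),
      mul_comm]

variable {M : Type x} [Ring M] [Bialgebra k M]

/-- A criterion for `f(x₁) g(x₂) = ε(x) 1`. It does not suffice that both sides pair equally with
`T`, since `M → Hom(T, A)` need not be injective; but if in addition the image of
`x ↦ f(x₁) g(x₂) - ε(x) 1` is a coideal, then this coideal vanishes. The comultiplication
condition `hcomul` is asked modulo every subspace `I` containing that image. -/
theorem IsUniversalMeasuring.convMul_eq_one [Ring T] [Algebra k T] [Ring A] [Algebra k A]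
    {θ : M →ₗ[k] T →ₗ[k] A} (hθ : IsUniversalMeasuring θ) {f g : M →ₗ[k] M}
    (hf : counit ∘ₗ f = counit (R := k)) (hg : counit ∘ₗ g = counit (R := k))
    (hcomul : ∀ I : Submodule k M, (∀ x, (toConv f * toConv g - 1) x ∈ I) → ∀ x,
      TensorProduct.map I.mkQ I.mkQ (comul ((toConv f * toConv g) x)) =
        counit (R := k) x • (I.mkQ 1 ⊗ₜ I.mkQ 1))
    (hθfg : ∀ x, θ ((toConv f * toConv g) x) = θ (algebraMap k M (counit x))) :
    toConv f * toConv g = 1 := by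
  let I : Submodule k M := LinearMap.range (toConv f * toConv g - 1).ofConv
  have hI : I.IsCoideal :=
    { counit_eq_zero := by
        rintro _ ⟨x, rfl⟩
        have h : counit (R := k) ((toConv f * toConv g) x) = counit x := by
          rw [(ℛ k x).convMul_apply]
          have hf' (y : M) : counit (R := k) (f y) = counit y := LinearMap.congr_fun hf y
          have hg' (y : M) : counit (R := k) (g y) = counit y := LinearMap.congr_fun hg y
          simpa [hf', hg'] using congr(counit (R := k) $(sum_counit_smul (R := k) (ℛ k x)))
        change counit (R := k) ((toConv f * toConv g) x - algebraMap k M (counit x)) = 0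
        rw [map_sub, h, Bialgebra.counit_algebraMap, sub_self]
      map_mkQ_comul_eq_zero := by
        rintro _ ⟨x, rfl⟩
        change TensorProduct.map I.mkQ I.mkQ
          (comul ((toConv f * toConv g) x - algebraMap k M (counit x))) = 0
        rw [map_sub, map_sub, hcomul I (fun x => ⟨x, rfl⟩), Algebra.algebraMap_eq_smul_one]
        simp [Algebra.TensorProduct.one_def] }
  have h0 : I = ⊥ := hθ.eq_bot_of_isCoideal I <| by
    rintro _ ⟨x, rfl⟩
    change θ ((toConv f * toConv g) x - algebraMap k M (counit x)) = 0
    rw [map_sub, hθfg, sub_self]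
  exact sub_eq_zero.1 (ofConv_injective (LinearMap.range_eq_bot.1 h0))

/-- The antipode of `M` is the coalgebra map `σ` from the co-opposite coalgebra of `M` determined by
`θ(σ m, t) = θ(m, S t)`. -/
theorem IsUniversalMeasuring.exists_antipode [Ring T] [HopfAlgebra k T] [CommRing A] [Algebra k A]
    {θ : M →ₗ[k] T →ₗ[k] A} (hθ : IsUniversalMeasuring θ) (hθ' : IsMeasuring θ.flip) :
    ∃ σ : M →ₗ[k] M, toConv σ * toConv .id = 1 ∧ toConv .id * toConv σ = 1 := by
  obtain ⟨hθ1, hθm⟩ := isMeasuring_flip_iff.1 hθ'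
  obtain ⟨s, hs⟩ := hθ.exists_hom hθ.1.comp_antipode
  let σ : M →ₗ[k] M := s.toLinearMap ∘ₗ (CoOpposite.unop k M).symm.toLinearMap
  have hθσ (m : M) : θ (σ m) = θ m ∘ₗ HopfAlgebra.antipode k := hs _
  have hcounit : counit ∘ₗ σ = counit (R := k) :=
    LinearMap.ext fun m => CoalgHomClass.counit_comp_apply s _
  have hcomul : comul ∘ₗ σ = (TensorProduct.map σ σ ∘ₗ
      (TensorProduct.comm k M M).toLinearMap) ∘ₗ comul := by
    refine LinearMap.ext fun m => (CoalgHomClass.map_comp_comul_apply s _).symm.trans ?_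
    refine (congrArg _ (CoOpposite.comul_eq _)).trans ?_
    exact TensorProduct.map_map _ _ _ _ _
  have hcounit_alg (x : M) (t : T) : θ (algebraMap k M (counit x)) t =
      θ x (algebraMap k T (counit t)) := by
    have h : θ 1 t = algebraMap k A (counit t) := congr($hθ1 t)
    simp [Algebra.algebraMap_eq_smul_one, h, hθ.1.map_one, smul_smul, mul_comm]
  have hθ_conv (f g : M →ₗ[k] M) (x : M) (t : T) : θ ((toConv f * toConv g) x) t =
      ∑ i ∈ (ℛ k t).index, ∑ j ∈ (ℛ k x).index,
        θ (f ((ℛ k x).left j)) ((ℛ k t).left i) * θ (g ((ℛ k x).right j)) ((ℛ k t).right i) := by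
    rw [(ℛ k x).convMul_apply, map_sum, LinearMap.sum_apply, Finset.sum_comm]
    exact Finset.sum_congr rfl fun j _ =>
      (congr($(hθm _ _) t)).trans ((ℛ k t).convMul_apply _ _)
  have hcomul_conv (f g : M →ₗ[k] M) (x : M) : comul ((toConv f * toConv g) x) =
      LinearMap.mul' k (M ⊗[k] M) (TensorProduct.map (comul ∘ₗ f) (comul ∘ₗ g) (comul x)) :=
    LinearMap.congr_fun
      (LinearMap.algHom_comp_convMul_distrib (Bialgebra.comulAlgHom k M) (toConv f) (toConv g)) x
  refine ⟨σ, ?_, ?_⟩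
  · refine hθ.convMul_eq_one hcounit (by rfl) (fun I hI x => ?_) fun x => ?_
    · -- `Δ(σ(x₁) x₂) = σ(x₂) x₃ ⊗ σ(x₁) x₄`: the nested factor stands on the left.
      have h := congr(TensorProduct.comm k (M ⧸ I) (M ⧸ I) $(map_mkQ_nested_convMul σ .id I hI x))
      rw [map_smul, TensorProduct.comm_tmul] at h
      rw [← h, hcomul_conv, hcomul, LinearMap.comp_id,
        show TensorProduct.map ((TensorProduct.map σ σ ∘ₗ
          (TensorProduct.comm k M M).toLinearMap) ∘ₗ comul) (comul (R := k)) (comul x) =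
        TensorProduct.map (TensorProduct.map σ σ ∘ₗ (TensorProduct.comm k M M).toLinearMap) .id
          (TensorProduct.map (comul (R := k)) (comul (R := k)) (comul x)) by
          rw [TensorProduct.map_map]; rfl]
      generalize TensorProduct.map (comul (R := k)) (comul (R := k)) (comul x) = z
      refine LinearMap.congr_fun
        (f := TensorProduct.map I.mkQ I.mkQ ∘ₗ LinearMap.mul' k (M ⊗[k] M) ∘ₗ
          TensorProduct.map (TensorProduct.map σ σ ∘ₗ (TensorProduct.comm k M M).toLinearMap) .id)
        (g := (TensorProduct.comm k (M ⧸ I) (M ⧸ I)).toLinearMap ∘ₗ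
          TensorProduct.map I.mkQ I.mkQ ∘ₗ LinearMap.mul' k (M ⊗[k] M) ∘ₗ
          TensorProduct.map (TensorProduct.map σ σ)
            (TensorProduct.map .id .id ∘ₗ (TensorProduct.comm k M M).toLinearMap)) ?_ z
      ext a b c d
      simp
    · ext t
      simp_rw [hcounit_alg, hθ_conv, hθσ, LinearMap.comp_apply, LinearMap.id_apply,
        ← hθ.1.map_mul_repr (ℛ k x), ← map_sum,
        HopfAlgebra.sum_antipode_mul_eq_algebraMap_counit]
  · refine hθ.convMul_eq_one (by rfl) hcounit (fun I hI x => ?_) fun x => ?_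
    · rw [← map_mkQ_nested_convMul .id σ I hI x, hcomul_conv, hcomul, LinearMap.comp_id,
        TensorProduct.map_map, TensorProduct.map_id, LinearMap.id_comp]
    · ext t
      simp_rw [hcounit_alg, hθ_conv, hθσ, LinearMap.comp_apply, LinearMap.id_apply,
        ← hθ.1.map_mul_repr (ℛ k x), ← map_sum,
        HopfAlgebra.sum_mul_antipode_eq_algebraMap_counit]

theorem IsUniversalMeasuring.isHopf [Ring T] [Bialgebra k T] [CommRing A] [Algebra k A]
    {θ : M →ₗ[k] T →ₗ[k] A} (hθ : IsUniversalMeasuring θ) (hθ' : IsMeasuring θ.flip)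
    (hT : IsHopf k T) : IsHopf k M := by
  obtain ⟨h, rfl⟩ := hT
  obtain ⟨σ, h₁, h₂⟩ := hθ.exists_antipode hθ'
  exact ⟨.ofConvInverse σ h₁ h₂, rfl⟩

end Hopf

end

theorem mainTheorem2 {k : Type u} [Field k] {T : Type v} [Ring T] [Bialgebra k T]
    {A : Type w} [CommRing A] [Algebra k A]
    {M : Type (max u x)} [AddCommGroup M] [Module k M] [Coalgebra k M]
    (θ : M →ₗ[k] T →ₗ[k] A) (hθ : IsUniversalMeasuring θ) :
    ∃ S : AlgebraStructure k M,
      S.IsMeasuredBy θ ∧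
      ∃ (hm : S.MulIsCoalgHom) (h1 : S.OneIsCoalgHom),
        (∀ S' : AlgebraStructure k M, S'.MulIsCoalgHom → S'.IsMeasuredBy θ → S' = S) ∧
        (letI := S.toRing
         letI := S.toBialgebra hm h1
         IsUniversalBimeasuring (k := k) (B := M) (T := T) (A := A) θ ∧
         (IsHopf k T → IsHopf k M)) := by
  obtain ⟨S, hS, hm, h1⟩ := hθ.exists_algebraStructure
  refine ⟨S, hS, hm, h1, fun S' hm' hS' => hθ.algebraStructure_unique hm hm' hS hS', ?_⟩
  let := S.toRing
  let := S.toBialgebra hm h1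
  have hθ₀ : IsUniversalMeasuring (k := k) (M := M) (B := T) (A := A) θ := hθ
  exact ⟨hθ₀.isUniversalBimeasuring hS, hθ₀.isHopf hS⟩
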